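/- Let $m(\xi)=\sqrt{\tanh(\xi)/\xi}$ for $\xi\neq0$ and $m(0)=1$, and let $$K(x)=\frac1{2\pi}\int_{\mathbb R}m(\xi)e^{ix\xi}\,d\xi:=\lim_{R\to\infty}\frac1{2\pi}\int_{-R}^{R}m(\xi)e^{ix\xi}\,d\xi,\qquad x\neq0,$$ be the Whitham kernel (the inverse Fourier transform of $m$); this limit exists and is real for every $x\ne0$. For $0<P<\infty$, the periodised kernel $$K_P(x)=\sum_{n\in\mathbb Z}K(x+nP)$$ converges absolutely for every $x\in\mathbb R\setminus P\mathbb Z$, and is given there by the formula $$K_P(x)=\frac1\pi\sum_{n=1}^\infty\int_{(2n-1)\pi/2}^{n\pi}\frac{\cosh\bigl(s(x-\frac P2-P\lfloor\frac xP\rfloor)\bigr)}{\sinh(\frac P2 s)}\sqrt{\frac{|\tan s|}{s}}\,ds,$$ in which every integral and the series converge absolutely. Hence $K_P$ is of class $C^\infty$ on $\mathbb R\setminus P\mathbb Z$ and completely monotone on $(0,P/2)$, that is, $(-1)^nK_P^{(n)}(x)\ge0$ for all integers $n\ge0$ and all $x\in(0,P/2)$. In particular, $K_P$ is positive on $\mathbb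 R\setminus P\mathbb Z$, strictly decreasing on $(0,P/2)$, and convex on $(0,P)$. -/

import Mathlib

open scoped ContDiff

noncomputable section

namespace Whitham

/-- The Whitham symbol `m(ξ) = √(tanh ξ / ξ)`, with its continuous value `1` at `ξ = 0`. -/
def symbol (ξ : ℝ) : ℝ :=
  if ξ = 0 then 1 else √(Real.tanh ξ / ξ)

/-- The truncated Fourier inversion integral `(1 / 2π) ∫_{-R}^{R} m(ξ) exp(i x ξ) dξ`. -/
def truncatedKernel (x R : ℝ) : ℂ :=
  (1 / (2 * (Real.pi : ℂ))) *
    ∫ ξ in (-R)..R, (symbol ξ : ℂ) * Complex.exp (Complex.I * (x : ℂ) * (ξ : ℂ))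

/-- The Whitham kernel, the inverse Fourier transform
`K(x) = (1 / 2π) ∫_ℝ m(ξ) exp(i x ξ) dξ`. As `m` is not integrable, the integral is the
conditionally convergent one, `lim_{R → ∞} (1 / 2π) ∫_{-R}^{R}`, which exists for `x ≠ 0` and is
real there. -/
def kernel (x : ℝ) : ℝ :=
  (Filter.limUnder Filter.atTop (truncatedKernel x)).re

/-- The periodised Whitham kernel `K_P(x) = ∑_{n ∈ ℤ} K(x + n P)`. -/
def periodicKernel (P x : ℝ) : ℝ :=
  ∑' n : ℤ, kernel (x + n * P)

/-- The set `P ℤ` of integer multiples of `P`. -/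
def multiples (P : ℝ) : Set ℝ :=
  Set.range fun k : ℤ => (k : ℝ) * P

/-- The integrand of the closed formula,
`cosh (s (x - P/2 - P ⌊x/P⌋)) / sinh (P s / 2) * √(|tan s| / s)`. -/
def periodicIntegrand (P x s : ℝ) : ℝ :=
  Real.cosh (s * (x - P / 2 - P * (⌊x / P⌋ : ℝ))) / Real.sinh (P / 2 * s) *
    √(|Real.tan s| / s)

/-- `g` is completely monotone on the open interval `(a, b)`: it is of class `C^∞` there and
`(-1)^n g^{(n)} ≥ 0` on `(a, b)` for all `n ≥ 0`. -/
def CompletelyMonotoneOnIoo (g : ℝ → ℝ) (a b : ℝ) : Prop :=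
  ContDiffOn ℝ ∞ g (Set.Ioo a b) ∧
    ∀ n : ℕ, ∀ x ∈ Set.Ioo a b, 0 ≤ (-1) ^ n * iteratedDeriv n g x

end Whitham

end

/-! ### The holomorphic square root of `tanh z / z` on the quadrant -/

noncomputable section

namespace Whitham

open Complex MeasureTheory Filter Topology

/-! The Whitham kernel is a Laplace transform of a positive density, and periodising it sums a
geometric series under the integral.

For `x > 0` the symbol extends holomorphically to the first quadrant, and the half-line integral of
`m(ξ) e^{ixξ}` is rotated onto the positive imaginary axis by Cauchy's theorem. At `z = is` one has
`tanh z / z = tan s / s`. Where `tan s > 0` the root is real and, after the factor `i`, contributes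
nothing to the real part; where `tan s < 0` the root is `-i √(|tan s| / s)` and contributes `√(|tan
s| / s) e^{-xs}`. Since `m` is even, `K(x)` is `1/π` times the Laplace transform of this density at
`|x|` (`abs_re_integral_sub_laplace_le`, `kernel_eq_laplace`).

For `0 < y < P`, the sum of `e^{-(y+nP)s}` over `n ≥ 0` equals `e^{(P/2-y)s} / (2 sinh(Ps/2))`, and
the negative `n` give the same with `y` replaced by `P - y`. With `ν` the density divided by `2
sinh(Ps/2)` and `t = y - P/2`, this yields `K_P(y) = (1/π) ∫ 2 cosh(ts) dν(s)`
(`hasSum_laplace_add_nat_mul`, `hasSum_kernel`). Cutting the integral along the intervals where `tan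
< 0` gives the closed formula. Smoothness is analyticity of the moment generating function of `ν`;
all sign statements are read off from `cosh` and `sinh` under the integral. -/

lemma sinh_add_mul_I (a b : ℝ) : sinh ((a : ℂ) + b * I) =
    (Real.sinh a * Real.cos b : ℝ) + (Real.cosh a * Real.sin b : ℝ) * I := by
  rw [sinh_add, sinh_mul_I, cosh_mul_I]; push_cast; ring

lemma cosh_add_mul_I (a b : ℝ) : cosh ((a : ℂ) + b * I) =
    (Real.cosh a * Real.cos b : ℝ) + (Real.sinh a * Real.sin b : ℝ) * I := by
  rw [cosh_add, sinh_mul_I, cosh_mul_I]; push_cast; ring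

lemma normSq_sinh_add_mul_I (a b : ℝ) :
    normSq (sinh ((a : ℂ) + b * I)) = Real.sinh a ^ 2 + Real.sin b ^ 2 := by
  rw [sinh_add_mul_I, normSq_add_mul_I]
  nlinarith [Real.cosh_sq a, Real.sin_sq_add_cos_sq b]

lemma normSq_cosh_add_mul_I (a b : ℝ) :
    normSq (cosh ((a : ℂ) + b * I)) = Real.sinh a ^ 2 + Real.cos b ^ 2 := by
  rw [cosh_add_mul_I, normSq_add_mul_I]
  nlinarith [Real.cosh_sq a, Real.sin_sq_add_cos_sq b]

lemma cosh_add_mul_I_ne_zero {a : ℝ} (ha : 0 < a) (b : ℝ) : cosh ((a : ℂ) + b * I) ≠ 0 := by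
  rw [← normSq_pos, normSq_cosh_add_mul_I]
  have := Real.sinh_pos_iff.2 ha
  positivity

/-- The quotient `tanh z / z`. -/
def tanhQuot (z : ℂ) : ℂ := sinh z / cosh z / z

lemma tanhQuot_eq (a b : ℝ) : tanhQuot ((a : ℂ) + b * I) =
    (((Real.sinh a ^ 2 + Real.cos b ^ 2) * (a ^ 2 + b ^ 2))⁻¹ : ℝ) *
      ((a * (Real.sinh a * Real.cosh a) + b * (Real.sin b * Real.cos b) : ℝ) +
        (a * (Real.sin b * Real.cos b) - b * (Real.sinh a * Real.cosh a) : ℝ) * I) := by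
  have e : tanhQuot ((a : ℂ) + b * I) = sinh ((a : ℂ) + b * I) *
      (cosh ((a : ℂ) + b * I))⁻¹ * ((a : ℂ) + b * I)⁻¹ := by
    rw [tanhQuot, div_eq_mul_inv, div_eq_mul_inv]
  rw [e, Complex.inv_def (cosh _), Complex.inv_def ((a : ℂ) + _), normSq_cosh_add_mul_I,
    normSq_add_mul_I, sinh_add_mul_I, cosh_add_mul_I]
  have h1 := Real.cosh_sq a
  have h2 := Real.sin_sq_add_cos_sq b
  have key : ((Real.sinh a * Real.cos b : ℝ) + (Real.cosh a * Real.sin b : ℝ) * I) *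
      (starRingEnd ℂ) ((Real.cosh a * Real.cos b : ℝ) + (Real.sinh a * Real.sin b : ℝ) * I) *
      (starRingEnd ℂ) ((a : ℂ) + b * I) =
      ((a * (Real.sinh a * Real.cosh a) + b * (Real.sin b * Real.cos b) : ℝ) +
        (a * (Real.sin b * Real.cos b) - b * (Real.sinh a * Real.cosh a) : ℝ) * I) := by
    have h3 : ((Real.sinh a * Real.cos b : ℝ) + (Real.cosh a * Real.sin b : ℝ) * I) *
      (starRingEnd ℂ) ((Real.cosh a * Real.cos b : ℝ) + (Real.sinh a * Real.sin b : ℝ) * I) =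
      (Real.sinh a * Real.cosh a : ℝ) + (Real.sin b * Real.cos b : ℝ) * I := by
      apply Complex.ext
      · simp only [map_add, map_mul, conj_ofReal, conj_I, add_re, mul_re, ofReal_re, ofReal_im,
          I_re, I_im, neg_re, neg_im, mul_im, add_im]
        linear_combination (Real.sinh a * Real.cosh a) * h2
      · simp only [map_add, map_mul, conj_ofReal, conj_I, add_re, mul_re, ofReal_re, ofReal_im,
          I_re, I_im, neg_re, neg_im, mul_im, add_im]
        linear_combination (Real.sin b * Real.cos b) * h1
    rw [h3]
    apply Complex.ext <;>
    · simp only [map_add, map_mul, conj_ofReal, conj_I, add_re, mul_re, ofReal_re, ofReal_im,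
          I_re, I_im, neg_re, neg_im, mul_im, add_im]
      ring
  rw [← key, mul_inv]
  push_cast
  ring

/-- Inside the quadrant `sin b cos b ≤ b` and `a < sinh a cosh a` force `Im (tanh z / z) < 0`, so
multiplication by `i` lands in the right half-plane. On the imaginary axis the quotient is real of
either sign; the factor `i` keeps these boundary values off the cut as well. -/
lemma I_mul_tanhQuot_mem_slitPlane {a b : ℝ} (ha : 0 < a) (hb : 0 ≤ b) :
    I * tanhQuot ((a : ℂ) + b * I) ∈ slitPlane := by
  have hs := Real.sinh_pos_iff.2 ha
  have hc := Real.one_lt_cosh.2 ha.ne'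
  have hsa := Real.self_le_sinh_iff.2 ha.le
  have hr : 0 < ((Real.sinh a ^ 2 + Real.cos b ^ 2) * (a ^ 2 + b ^ 2))⁻¹ := by positivity
  rw [tanhQuot_eq, mem_slitPlane_iff]
  generalize ((Real.sinh a ^ 2 + Real.cos b ^ 2) * (a ^ 2 + b ^ 2))⁻¹ = r at hr
  rcases hb.eq_or_lt with rfl | hb
  · right
    simp only [mul_im, I_re, I_im, mul_re, add_re, add_im, ofReal_re, ofReal_im]
    refine ne_of_gt ?_
    simp
    positivity
  · left
    have h1 : Real.sin b * Real.cos b ≤ b := by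
      have h2 : Real.sin (2 * b) ≤ 2 * b := Real.sin_le (by linarith)
      rw [Real.sin_two_mul] at h2; linarith
    have h2 : a < Real.sinh a * Real.cosh a := by nlinarith
    simp only [mul_im, I_re, I_im, mul_re, add_re, add_im, ofReal_re, ofReal_im]
    have : a * (Real.sin b * Real.cos b) < b * (Real.sinh a * Real.cosh a) := by nlinarith
    nlinarith

/-- The holomorphic branch of `√(tanh z / z)` on the quadrant `0 < re z`, `0 ≤ im z`, whose
boundary values on the positive imaginary axis are attained continuously. -/
def branch (z : ℂ) : ℂ :=
  exp (-(Real.pi / 4 : ℝ) * I) * (I * tanhQuot z) ^ ((1 / 2 : ℝ) : ℂ)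

lemma norm_branch (z : ℂ) : ‖branch z‖ = √‖tanhQuot z‖ := by
  rw [branch, norm_mul, norm_cpow_real, norm_mul, norm_I, one_mul, Real.sqrt_eq_rpow,
    ← ofReal_neg, norm_exp_ofReal_mul_I, one_mul]

lemma differentiableAt_branch {a b : ℝ} (ha : 0 < a) (hb : 0 ≤ b) :
    DifferentiableAt ℂ branch ((a : ℂ) + b * I) := by
  have h0 : (a : ℂ) + b * I ≠ 0 := fun h => by
    have := congrArg re h; simp at this; exact ha.ne' this
  have hq : DifferentiableAt ℂ tanhQuot ((a : ℂ) + b * I) :=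
    ((differentiable_sinh _).div (differentiable_cosh _) (cosh_add_mul_I_ne_zero ha b)).div
      differentiableAt_id h0
  exact ((hq.const_mul I).cpow_const (I_mul_tanhQuot_mem_slitPlane ha hb)).const_mul _

lemma I_mul_ofReal_cpow {r : ℝ} (hr : 0 < r) :
    exp (-(Real.pi / 4 : ℝ) * I) * (I * (r : ℂ)) ^ ((1 / 2 : ℝ) : ℂ) = (√r : ℝ) := by
  have hr' : (r : ℂ) ≠ 0 := by exact_mod_cast hr.ne'
  rw [mul_comm I, cpow_def_of_ne_zero (mul_ne_zero hr' I_ne_zero), log_ofReal_mul hr I_ne_zero,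
    log_I, ← Complex.exp_add, Real.sqrt_eq_rpow, Real.rpow_def_of_pos hr, ofReal_exp]
  congr 1; push_cast; ring

/-- The phases add up: `-π/4` from the prefactor and `-π/4` from the root of `-i`. The resulting
`-i` is what makes the negative part of `tan` visible in the real part. -/
lemma I_mul_neg_ofReal_cpow {r : ℝ} (hr : 0 < r) :
    exp (-(Real.pi / 4 : ℝ) * I) * (I * ((-r : ℝ) : ℂ)) ^ ((1 / 2 : ℝ) : ℂ) = -I * (√r : ℝ) := by
  have hr' : (r : ℂ) ≠ 0 := by exact_mod_cast hr.ne'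
  have : I * ((-r : ℝ) : ℂ) = r * -I := by push_cast; ring
  rw [this, cpow_def_of_ne_zero (mul_ne_zero hr' (neg_ne_zero.2 I_ne_zero)),
    log_ofReal_mul hr (neg_ne_zero.2 I_ne_zero), log_neg_I, ← Complex.exp_add, Real.sqrt_eq_rpow,
    Real.rpow_def_of_pos hr, ofReal_exp, ← exp_neg_pi_div_two_mul_I, ← Complex.exp_add]
  congr 1; push_cast; ring

lemma tanhQuot_ofReal (x : ℝ) : tanhQuot x = (Real.tanh x / x : ℝ) := by
  rw [tanhQuot, Real.tanh_eq_sinh_div_cosh]; push_cast; rfl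

lemma tanhQuot_mul_I (s : ℝ) : tanhQuot (s * I) = (Real.tan s / s : ℝ) := by
  rw [tanhQuot, sinh_mul_I, cosh_mul_I, mul_div_right_comm, mul_div_mul_right _ _ I_ne_zero,
    Real.tan_eq_sin_div_cos]
  push_cast; rfl

lemma tanh_pos {x : ℝ} (hx : 0 < x) : 0 < Real.tanh x := by
  rw [Real.tanh_eq_sinh_div_cosh]
  exact div_pos (Real.sinh_pos_iff.2 hx) (Real.cosh_pos x)

lemma branch_ofReal {x : ℝ} (hx : 0 < x) : branch x = symbol x := by
  rw [branch, tanhQuot_ofReal, I_mul_ofReal_cpow (div_pos (tanh_pos hx) hx), symbol,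
    if_neg hx.ne']

/-- The spectral density `√(|tan s| / s)`. -/
def weight (s : ℝ) : ℝ := √(|Real.tan s| / s)

lemma I_mul_branch_mul_I_re {s : ℝ} (hs : 0 < s) (ht : Real.tan s ≠ 0) :
    (I * branch (s * I)).re = if Real.tan s < 0 then weight s else 0 := by
  rw [branch, tanhQuot_mul_I, weight]
  split_ifs with h
  · have : Real.tan s / s = -(|Real.tan s| / s) := by rw [abs_of_neg h]; ring
    rw [this, I_mul_neg_ofReal_cpow (by positivity)]
    simp
  · have h' : 0 < Real.tan s := lt_of_le_of_ne (not_lt.1 h) ht.symm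
    rw [I_mul_ofReal_cpow (by positivity)]
    simp

lemma continuousAt_branch_mul_I {s : ℝ} (hs : 0 < s) (ht : Real.tan s ≠ 0) :
    ContinuousAt branch (s * I) := by
  -- `Real.tan` takes the value `0` at its poles, so `tan s ≠ 0` excludes both zeros and poles.
  have hc : Real.cos s ≠ 0 := fun h => ht (by rw [Real.tan_eq_sin_div_cos, h, div_zero])
  have h0 : (s : ℂ) * I ≠ 0 := mul_ne_zero (by exact_mod_cast hs.ne') I_ne_zero
  have hq : ContinuousAt tanhQuot (s * I) := by
    refine ((differentiable_sinh _).continuousAt.div (differentiable_cosh _).continuousAt ?_).div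
      continuousAt_id h0
    rw [cosh_mul_I, ← ofReal_cos]; exact_mod_cast hc
  refine ContinuousAt.mul continuousAt_const ((continuousAt_const.mul hq).cpow
    continuousAt_const ?_)
  change I * tanhQuot (s * I) ∈ slitPlane
  rw [tanhQuot_mul_I, mem_slitPlane_iff]
  right
  simpa using ⟨ht, hs.ne'⟩

lemma norm_tanhQuot_le {a b C : ℝ} (hC : 0 ≤ C) (ha : 0 < a)
    (h : Real.sinh a ^ 2 + Real.sin b ^ 2 ≤
      C ^ 2 * ((Real.sinh a ^ 2 + Real.cos b ^ 2) * (a ^ 2 + b ^ 2))) :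
    ‖tanhQuot ((a : ℂ) + b * I)‖ ≤ C := by
  have hs := Real.sinh_pos_iff.2 ha
  refine abs_le_of_sq_le_sq' ?_ hC |>.2
  rw [← normSq_eq_norm_sq, tanhQuot, map_div₀, map_div₀, normSq_sinh_add_mul_I,
    normSq_cosh_add_mul_I, normSq_add_mul_I, div_div, div_le_iff₀ (by positivity)]
  exact h

lemma sinh_le_two_mul {a : ℝ} (ha : 0 ≤ a) (ha1 : a ≤ 1) : Real.sinh a ≤ 2 * a := by
  have h1 := abs_le.1 (Real.abs_exp_sub_one_sub_id_le (x := a) (abs_le.2 ⟨by linarith, ha1⟩))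
  have h2 := abs_le.1 (Real.abs_exp_sub_one_sub_id_le (x := -a)
    (abs_le.2 ⟨by linarith, by linarith⟩))
  rw [Real.sinh_eq]
  nlinarith

/-- Uses `|sinh z| ≤ 2|z|` and `|cosh z| ≥ |cos b|`. The bound does not depend on `a`, so it
dominates the left side of the contour as that side approaches the imaginary axis. -/
lemma norm_branch_le_of_re_le_one {a b : ℝ} (ha : 0 < a) (ha1 : a ≤ 1) (hb : 0 ≤ b)
    (hc : Real.cos b ≠ 0) :
    ‖branch ((a : ℂ) + b * I)‖ ≤ √(2 / |Real.cos b|) := by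
  rw [norm_branch]
  refine Real.sqrt_le_sqrt (norm_tanhQuot_le (by positivity) ha ?_)
  have h1 := sinh_le_two_mul ha.le ha1
  have h0 := Real.sinh_pos_iff.2 ha
  have h2 : Real.sin b ^ 2 ≤ b ^ 2 := sq_le_sq.2 (by
    rw [abs_of_nonneg hb]; exact (Real.abs_sin_le_abs).trans_eq (abs_of_nonneg hb))
  have hc' : 0 < Real.cos b ^ 2 := by positivity
  rw [div_pow, sq_abs, div_mul_eq_mul_div, le_div_iff₀ hc']
  have h3 : Real.sinh a ^ 2 + Real.sin b ^ 2 ≤ 2 ^ 2 * (a ^ 2 + b ^ 2) := by nlinarith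
  have h4 : Real.cos b ^ 2 ≤ Real.sinh a ^ 2 + Real.cos b ^ 2 := by nlinarith
  calc _ ≤ 2 ^ 2 * (a ^ 2 + b ^ 2) * (Real.sinh a ^ 2 + Real.cos b ^ 2) := by gcongr
    _ = _ := by ring

/-- For the top side of the contour, placed at height `kπ` to stay away from the poles: there `|sinh
z| ≤ |cosh z|` and `|z| ≥ 1`. -/
lemma norm_branch_le_one {a b : ℝ} (ha : 0 < a) (hb : 1 ≤ b) (hs : Real.sin b = 0) :
    ‖branch ((a : ℂ) + b * I)‖ ≤ 1 := by
  rw [norm_branch, Real.sqrt_le_iff, one_pow]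
  refine ⟨zero_le_one, norm_tanhQuot_le zero_le_one ha ?_⟩
  have h1 : Real.cos b ^ 2 = 1 := by have := Real.sin_sq_add_cos_sq b; rw [hs] at this; linarith
  rw [hs, h1]
  have h2 : 1 ≤ a ^ 2 + b ^ 2 := by nlinarith
  nlinarith [sq_nonneg (Real.sinh a)]

/-- For the right side of the contour: `|tanh z| ≤ 2` once `sinh a ≥ 1`, and `|z| ≥ a`. -/
lemma norm_branch_le_of_one_le_re {a : ℝ} (ha : 1 ≤ a) (b : ℝ) :
    ‖branch ((a : ℂ) + b * I)‖ ≤ √(2 / a) := by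
  have ha0 : 0 < a := by linarith
  rw [norm_branch]
  refine Real.sqrt_le_sqrt (norm_tanhQuot_le (by positivity) ha0 ?_)
  have h1 := Real.self_le_sinh_iff.2 ha0.le
  rw [div_pow, div_mul_eq_mul_div, le_div_iff₀ (by positivity)]
  have h2 : 1 ≤ Real.sinh a ^ 2 := by nlinarith
  have h3 : Real.sinh a ^ 2 + Real.sin b ^ 2 ≤
    2 ^ 2 * (Real.sinh a ^ 2 + Real.cos b ^ 2) := by
    nlinarith [Real.sin_sq_le_one b, sq_nonneg (Real.cos b)]
  have h4 : a ^ 2 ≤ a ^ 2 + b ^ 2 := by nlinarith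
  calc _ ≤ (2 ^ 2 * (Real.sinh a ^ 2 + Real.cos b ^ 2)) * (a ^ 2 + b ^ 2) := by gcongr
    _ = _ := by ring

end Whitham
end

/-! ### Integrability of the spectral density -/

noncomputable section

namespace Whitham

open Complex MeasureTheory Filter Topology

/-- The `π`-periodic, locally integrable majorant `√(2 / |cos s|)` of the spectral density. -/
def majorant (s : ℝ) : ℝ := √(2 / |Real.cos s|)

lemma majorant_nonneg (s : ℝ) : 0 ≤ majorant s := Real.sqrt_nonneg _

lemma periodic_majorant : Function.Periodic majorant Real.pi := fun s => by
  simp only [majorant, Real.cos_add_pi, abs_neg]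

/-- Jordan's inequality `sin s ≥ 2s/π` gives the integrable majorant `√(π/s)`. -/
lemma intervalIntegrable_sqrt_two_div_sin :
    IntervalIntegrable (fun s : ℝ => √(2 / |Real.sin s|)) volume 0 (Real.pi / 2) := by
  have h : IntervalIntegrable (fun s : ℝ => √Real.pi * s ^ (-(1 / 2) : ℝ)) volume 0
      (Real.pi / 2) := (intervalIntegral.intervalIntegrable_rpow' (by norm_num)).const_mul _
  refine h.mono_fun' (measurable_const.div Real.measurable_sin.abs).sqrt.aestronglyMeasurable ?_
  rw [Set.uIoc_of_le (by positivity)]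
  refine (ae_restrict_iff' measurableSet_Ioc).2 (Eventually.of_forall fun s hs => ?_)
  have h1 := Real.mul_le_sin hs.1.le hs.2
  have h2 : 0 < 2 / Real.pi * s := mul_pos (by positivity) hs.1
  change ‖√(2 / |Real.sin s|)‖ ≤ √Real.pi * s ^ (-(1 / 2) : ℝ)
  rw [Real.norm_of_nonneg (Real.sqrt_nonneg _), Real.rpow_neg hs.1.le, ← Real.sqrt_eq_rpow,
    ← Real.sqrt_inv, ← Real.sqrt_mul Real.pi_pos.le]
  refine Real.sqrt_le_sqrt ?_
  rw [abs_of_pos (h2.trans_le h1), div_le_iff₀ (h2.trans_le h1)]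
  have hs0 : s ≠ 0 := hs.1.ne'
  calc (2 : ℝ) = Real.pi * s⁻¹ * (2 / Real.pi * s) := by field_simp
    _ ≤ _ := mul_le_mul_of_nonneg_left h1 (by have := hs.1; positivity)

lemma intervalIntegrable_majorant (a b : ℝ) : IntervalIntegrable majorant volume a b := by
  have h := intervalIntegrable_sqrt_two_div_sin
  have h1 : IntervalIntegrable majorant volume 0 (Real.pi / 2) := by
    have := (h.comp_sub_left (Real.pi / 2)).symm
    simp only [Real.sin_pi_div_two_sub, sub_zero, sub_self] at this
    exact this
  have h2 : IntervalIntegrable majorant volume (Real.pi / 2) Real.pi := by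
    have := h.comp_sub_right (Real.pi / 2)
    simp only [Real.sin_sub_pi_div_two, abs_neg, zero_add, add_halves] at this
    exact this
  refine periodic_majorant.intervalIntegrable Real.pi_ne_zero (t := 0) ?_ a b
  rw [zero_add]
  exact h1.trans h2

/-- The integral over the `k`-th period is at most `J r^k`, so the integrals up to `nπ` are bounded
by a geometric series. -/
lemma integrableOn_majorant_mul_exp {x : ℝ} (hx : 0 < x) :
    IntegrableOn (fun s => majorant s * Real.exp (-x * s)) (Set.Ioi 0) := by
  have hi : ∀ a b : ℝ, IntervalIntegrable (fun s => majorant s * Real.exp (-x * s)) volume a b :=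
    fun a b => (intervalIntegrable_majorant a b).mul_continuousOn (by fun_prop)
  set J := ∫ s in (0 : ℝ)..Real.pi, majorant s with hJ
  set r := Real.exp (-x * Real.pi) with hr
  have hr1 : r < 1 := by
    rw [hr, ← Real.exp_zero, Real.exp_lt_exp]; nlinarith [Real.pi_pos]
  have hr0 : 0 < r := Real.exp_pos _
  have hJ0 : 0 ≤ J := intervalIntegral.integral_nonneg Real.pi_pos.le fun s _ => majorant_nonneg s
  refine integrableOn_Ioi_of_intervalIntegral_norm_bounded (l := atTop)
    (b := fun n : ℕ => (n : ℝ) * Real.pi) (J * (1 - r)⁻¹) 0 ?_ ?_ ?_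
  · intro n
    exact (intervalIntegrable_iff_integrableOn_Ioc_of_le (by positivity)).1 (hi _ _)
  · exact tendsto_natCast_atTop_atTop.atTop_mul_const Real.pi_pos
  · refine Eventually.of_forall fun n => ?_
    have h0 : ∀ s, ‖majorant s * Real.exp (-x * s)‖ = majorant s * Real.exp (-x * s) := fun s =>
      Real.norm_of_nonneg (mul_nonneg (majorant_nonneg s) (Real.exp_pos _).le)
    simp only [h0]
    have hsum := intervalIntegral.sum_integral_adjacent_intervals
      (f := fun s => majorant s * Real.exp (-x * s)) (μ := volume)
      (a := fun k : ℕ => (k : ℝ) * Real.pi) (n := n) (fun k _ => hi _ _)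
    simp only [Nat.cast_zero, zero_mul] at hsum
    rw [← hsum]
    have hk : ∀ k : ℕ, (∫ s in ((k : ℝ) * Real.pi)..(((k + 1 : ℕ) : ℝ) * Real.pi),
        majorant s * Real.exp (-x * s)) ≤ J * r ^ k := by
      intro k
      have e : (∫ s in ((k : ℝ) * Real.pi)..(((k + 1 : ℕ) : ℝ) * Real.pi), majorant s) = J := by
        have := periodic_majorant.intervalIntegral_add_eq ((k : ℝ) * Real.pi) 0
        rw [zero_add] at this
        rw [hJ, ← this]
        congr 1; push_cast; ring
      rw [← e, ← intervalIntegral.integral_mul_const]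
      have hle : (k : ℝ) * Real.pi ≤ ((k + 1 : ℕ) : ℝ) * Real.pi := by
        push_cast; nlinarith [Real.pi_pos]
      refine intervalIntegral.integral_mono_on hle (hi _ _)
        ((intervalIntegrable_majorant _ _).mul_const _) fun s hs => ?_
      refine mul_le_mul_of_nonneg_left ?_ (majorant_nonneg s)
      rw [hr, ← Real.exp_nat_mul]
      exact Real.exp_le_exp.2 (by nlinarith [hs.1])
    calc _ ≤ ∑ k ∈ Finset.range n, J * r ^ k := Finset.sum_le_sum fun k _ => hk k
      _ = J * ∑ k ∈ Finset.range n, r ^ k := by rw [Finset.mul_sum]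
      _ ≤ J * (1 - r)⁻¹ := by
        refine mul_le_mul_of_nonneg_left ?_ hJ0
        rw [← tsum_geometric_of_lt_one hr0.le hr1]
        exact (summable_geometric_of_lt_one hr0.le hr1).sum_le_tsum _ fun i _ => by positivity

/-- The spectral density of the Whitham kernel: `√(|tan s| / s)` where `tan s < 0`. -/
def density (s : ℝ) : ℝ := if Real.tan s < 0 then weight s else 0

lemma measurable_tan : Measurable Real.tan := by
  have : Real.tan = fun s => Real.sin s / Real.cos s := funext Real.tan_eq_sin_div_cos
  rw [this]
  exact Real.measurable_sin.div Real.measurable_cos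

lemma measurable_weight : Measurable weight :=
  (measurable_tan.abs.div measurable_id).sqrt

lemma measurable_density : Measurable density :=
  Measurable.ite (measurableSet_lt measurable_tan measurable_const) measurable_weight
    measurable_const

lemma weight_nonneg (s : ℝ) : 0 ≤ weight s := Real.sqrt_nonneg _

lemma density_nonneg (s : ℝ) : 0 ≤ density s := by
  rw [density]; split_ifs <;> simp [weight_nonneg]

lemma weight_le_majorant {s : ℝ} (hs : 0 < s) : weight s ≤ majorant s := by
  refine Real.sqrt_le_sqrt ?_
  rw [Real.tan_eq_sin_div_cos, abs_div, div_right_comm]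
  gcongr
  rw [div_le_iff₀ hs]
  have := Real.abs_sin_le_abs (x := s)
  rw [abs_of_pos hs] at this
  linarith

lemma density_le_majorant {s : ℝ} (hs : 0 < s) : density s ≤ majorant s := by
  rw [density]; split_ifs
  exacts [weight_le_majorant hs, majorant_nonneg s]

lemma integrableOn_density_mul_exp {x : ℝ} (hx : 0 < x) :
    IntegrableOn (fun s => density s * Real.exp (-x * s)) (Set.Ioi 0) := by
  refine (integrableOn_majorant_mul_exp hx).mono'
    (measurable_density.mul (by fun_prop)).aestronglyMeasurable ?_
  refine (ae_restrict_iff' measurableSet_Ioi).2 (Eventually.of_forall fun s hs => ?_)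
  rw [Real.norm_of_nonneg (mul_nonneg (density_nonneg s) (Real.exp_pos _).le)]
  exact mul_le_mul_of_nonneg_right (density_le_majorant hs) (Real.exp_pos _).le

lemma ae_tan_ne_zero : ∀ᵐ s : ℝ, Real.tan s ≠ 0 := by
  have h : {s : ℝ | Real.tan s = 0} ⊆ Set.range fun n : ℤ => (n : ℝ) * Real.pi / 2 := by
    intro s hs
    obtain ⟨k, hk⟩ := Real.tan_eq_zero_iff.1 hs
    exact ⟨k, by rw [← hk]⟩
  have := (Set.countable_range fun n : ℤ => (n : ℝ) * Real.pi / 2).mono h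
  filter_upwards [this.ae_notMem volume] with s hs using hs

end Whitham
end

/-! ### Contour rotation and the Laplace representation of the kernel -/

noncomputable section

namespace Whitham

open Complex MeasureTheory Filter Topology

lemma symbol_neg (ξ : ℝ) : symbol (-ξ) = symbol ξ := by
  simp only [symbol, neg_eq_zero, Real.tanh_neg, neg_div_neg_eq]

lemma symbol_nonneg (ξ : ℝ) : 0 ≤ symbol ξ := by
  rw [symbol]; split_ifs <;> positivity

lemma measurable_symbol : Measurable symbol := by
  have h : Real.tanh = fun s => Real.sinh s / Real.cosh s :=
    funext Real.tanh_eq_sinh_div_cosh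
  have ht : Measurable Real.tanh := by
    rw [h]; exact Real.measurable_sinh.div Real.measurable_cosh
  exact Measurable.ite (measurableSet_singleton 0) measurable_const (ht.div measurable_id).sqrt

/-- A crude constant suffices: it comes from the two bounds on `branch`, taken on the real axis. -/
lemma symbol_le_of_pos {ξ : ℝ} (h : 0 < ξ) : symbol ξ ≤ √2 := by
  have e : symbol ξ = ‖branch ((ξ : ℂ) + (0 : ℝ) * I)‖ := by
    rw [ofReal_zero, zero_mul, add_zero, branch_ofReal h, norm_real,
      Real.norm_of_nonneg (symbol_nonneg _)]
  rw [e]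
  rcases le_total ξ 1 with h1 | h1
  · simpa using norm_branch_le_of_re_le_one h h1 le_rfl (by simp)
  · refine (norm_branch_le_of_one_le_re h1 0).trans (Real.sqrt_le_sqrt ?_)
    exact div_le_self zero_le_two h1

lemma symbol_le (ξ : ℝ) : symbol ξ ≤ √2 := by
  rcases lt_trichotomy ξ 0 with h | rfl | h
  · rw [← symbol_neg]; exact symbol_le_of_pos (neg_pos.2 h)
  · rw [symbol, if_pos rfl]; exact Real.one_le_sqrt.2 one_le_two
  · exact symbol_le_of_pos h

lemma norm_exp_I_mul (x a b : ℝ) : ‖exp (I * x * ((a : ℂ) + b * I))‖ = Real.exp (-x * b) := by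
  rw [norm_exp]; congr 1; simp

lemma intervalIntegrable_symbol_mul_exp (x a b : ℝ) :
    IntervalIntegrable (fun ξ : ℝ => (symbol ξ : ℂ) * exp (I * x * ξ)) volume a b := by
  refine (intervalIntegrable_const (c := √2)).mono_fun' ?_ (Eventually.of_forall fun ξ => ?_)
  · exact ((measurable_ofReal.comp measurable_symbol).mul (by fun_prop)).aestronglyMeasurable
  · have := norm_exp_I_mul x ξ 0
    rw [ofReal_zero, zero_mul, add_zero, mul_zero, Real.exp_zero] at this
    change ‖(symbol ξ : ℂ) * exp (I * x * ξ)‖ ≤ √2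
    rw [norm_mul, this, mul_one, norm_real, Real.norm_of_nonneg (symbol_nonneg _)]
    exact symbol_le ξ

/-- The integrand of the contour integral. -/
def contourIntegrand (x : ℝ) (z : ℂ) : ℂ := branch z * exp (I * x * z)

lemma norm_contourIntegrand (x a b : ℝ) : ‖contourIntegrand x ((a : ℂ) + b * I)‖ =
    ‖branch ((a : ℂ) + b * I)‖ * Real.exp (-x * b) := by
  rw [contourIntegrand, norm_mul, norm_exp_I_mul]

lemma contourIntegrand_ofReal (x : ℝ) {ξ : ℝ} (h : 0 < ξ) :
    contourIntegrand x ξ = (symbol ξ : ℂ) * exp (I * x * ξ) := by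
  rw [contourIntegrand, branch_ofReal h]

lemma differentiableAt_contourIntegrand (x : ℝ) {a b : ℝ} (ha : 0 < a) (hb : 0 ≤ b) :
    DifferentiableAt ℂ (contourIntegrand x) ((a : ℂ) + b * I) :=
  (differentiableAt_branch ha hb).mul (by fun_prop)

/-- Cauchy's theorem on the rectangle `[ε, R] × [0, kπ]`. The error terms bound the right and top
sides; starting at `ε > 0` avoids the singularities on the imaginary axis. -/
lemma norm_contour_difference_le {x R ε : ℝ} {k : ℕ} (hx : 0 < x) (hR : 1 ≤ R) (hk : 1 ≤ k)
    (hε : 0 < ε) (hε1 : ε ≤ 1) :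
    ‖(∫ ξ in ε..R, (symbol ξ : ℂ) * exp (I * x * ξ)) -
      I * ∫ s in (0 : ℝ)..(k * Real.pi), contourIntegrand x ((ε : ℂ) + s * I)‖ ≤
      √(2 / R) / x + R * Real.exp (-x * (k * Real.pi)) := by
  set b : ℝ := k * Real.pi with hb
  have hk' : (1 : ℝ) ≤ k := by exact_mod_cast hk
  have hb1 : 1 ≤ b := by nlinarith [Real.pi_gt_three]
  have hεR : ε ≤ R := hε1.trans hR
  have hC := integral_boundary_rect_eq_zero_of_differentiableOn (contourIntegrand x)
    ((ε : ℂ) + (0 : ℝ) * I) ((R : ℂ) + b * I) (by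
      intro z hz
      rw [mem_reProdIm] at hz
      simp only [add_re, ofReal_re, mul_re, I_re, mul_zero, ofReal_im, I_im, mul_one, sub_self,
        add_zero, add_im, mul_im, zero_add, Set.uIcc_of_le hεR,
        Set.uIcc_of_le (zero_le_one.trans hb1)] at hz
      rw [← re_add_im z]
      exact (differentiableAt_contourIntegrand x (hε.trans_le hz.1.1)
        hz.2.1).differentiableWithinAt)
  simp only [add_re, ofReal_re, mul_re, I_re, mul_zero, ofReal_im, I_im, mul_one, sub_self,
    add_zero, add_im, mul_im, zero_add, ofReal_zero, zero_mul, smul_eq_mul] at hC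
  have hbot : (∫ ξ in ε..R, contourIntegrand x ξ) =
      ∫ ξ in ε..R, (symbol ξ : ℂ) * exp (I * x * ξ) := by
    refine intervalIntegral.integral_congr fun ξ hξ => ?_
    rw [Set.uIcc_of_le hεR] at hξ
    exact contourIntegrand_ofReal x (hε.trans_le hξ.1)
  rw [hbot] at hC
  have htop : ‖∫ ξ in ε..R, contourIntegrand x ((ξ : ℂ) + b * I)‖ ≤ R * Real.exp (-x * b) := by
    refine (intervalIntegral.norm_integral_le_of_norm_le_const (C := Real.exp (-x * b))
      fun ξ hξ => ?_).trans ?_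
    · rw [Set.uIoc_of_le hεR] at hξ
      rw [norm_contourIntegrand]
      exact mul_le_of_le_one_left (Real.exp_pos _).le
        (norm_branch_le_one (hε.trans hξ.1) hb1 (Real.sin_nat_mul_pi k))
    · rw [mul_comm, abs_of_nonneg (by linarith)]
      exact mul_le_mul_of_nonneg_right (by linarith) (Real.exp_pos _).le
  have hright : ‖∫ s in (0 : ℝ)..b, contourIntegrand x ((R : ℂ) + s * I)‖ ≤ √(2 / R) / x := by
    have hint : IntegrableOn (fun s => √(2 / R) * Real.exp (-x * s)) (Set.Ioi 0) :=
      (integrableOn_exp_mul_Ioi (neg_lt_zero.2 hx) 0).const_mul _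
    have hsub : Set.Ioc 0 b ⊆ Set.Ioi 0 := fun s hs => hs.1
    refine (intervalIntegral.norm_integral_le_of_norm_le
      (g := fun s => √(2 / R) * Real.exp (-x * s)) (by linarith)
      (Eventually.of_forall fun s _ => ?_) ?_).trans ?_
    · rw [norm_contourIntegrand]
      exact mul_le_mul_of_nonneg_right (norm_branch_le_of_one_le_re hR s) (Real.exp_pos _).le
    · exact (intervalIntegrable_iff_integrableOn_Ioc_of_le (by linarith)).2 (hint.mono_set hsub)
    · rw [intervalIntegral.integral_of_le (by linarith)]
      refine (setIntegral_mono_set hint (Eventually.of_forall fun s => by positivity)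
        hsub.eventuallyLE).trans_eq ?_
      rw [integral_const_mul, integral_exp_mul_Ioi (neg_lt_zero.2 hx)]
      simp [div_eq_mul_inv]
  have e : (∫ ξ in ε..R, (symbol ξ : ℂ) * exp (I * x * ξ)) -
      I * ∫ s in (0 : ℝ)..b, contourIntegrand x ((ε : ℂ) + s * I) =
      (∫ ξ in ε..R, contourIntegrand x ((ξ : ℂ) + b * I)) -
      I * ∫ s in (0 : ℝ)..b, contourIntegrand x ((R : ℂ) + s * I) := by
    linear_combination hC
  rw [e]
  refine (norm_sub_le _ _).trans ?_
  rw [norm_mul, norm_I, one_mul, add_comm]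
  exact add_le_add hright htop

/-- Dominated convergence as the left side moves onto the imaginary axis: `majorant` dominates for
`ε < 1`, and pointwise convergence holds off the countable set of zeros and poles of `tan`. -/
lemma tendsto_re_integral_contour {x : ℝ} (hx : 0 < x) {b : ℝ} (hb : 0 ≤ b) :
    Tendsto (fun ε : ℝ => (I * ∫ s in (0 : ℝ)..b, contourIntegrand x ((ε : ℂ) + s * I)).re)
      (𝓝[>] 0) (𝓝 (∫ s in (0 : ℝ)..b, density s * Real.exp (-x * s))) := by
  have hcont : ∀ ε : ℝ, 0 < ε →
      ContinuousOn (fun s : ℝ => I * contourIntegrand x ((ε : ℂ) + s * I)) (Set.uIcc 0 b) := by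
    intro ε hε s hs
    rw [Set.uIcc_of_le hb] at hs
    refine ContinuousAt.continuousWithinAt (continuousAt_const.mul ?_)
    exact ContinuousAt.comp (f := fun s : ℝ => (ε : ℂ) + s * I)
      (differentiableAt_contourIntegrand x hε hs.1).continuousAt (by fun_prop)
  have hre : ∀ᶠ ε : ℝ in 𝓝[>] 0,
      ∫ s in (0 : ℝ)..b, (I * contourIntegrand x ((ε : ℂ) + s * I)).re =
      (I * ∫ s in (0 : ℝ)..b, contourIntegrand x ((ε : ℂ) + s * I)).re := by
    filter_upwards [self_mem_nhdsWithin] with ε hε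
    rw [← intervalIntegral.integral_const_mul]
    exact reCLM.intervalIntegral_comp_comm (hcont ε hε).intervalIntegrable
  refine Tendsto.congr' hre ?_
  have hae : ∀ᵐ s : ℝ, Real.tan s ≠ 0 := ae_tan_ne_zero
  have hIoc : Set.Ioo (0 : ℝ) 1 ∈ 𝓝[>] (0 : ℝ) := Ioo_mem_nhdsGT zero_lt_one
  refine intervalIntegral.tendsto_integral_filter_of_dominated_convergence majorant ?_ ?_
    (intervalIntegrable_majorant 0 b) ?_
  · filter_upwards [self_mem_nhdsWithin] with ε hε
    have h1 := (hcont ε hε).mono Set.uIoc_subset_uIcc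
    exact ((continuous_re.comp_continuousOn h1).aestronglyMeasurable measurableSet_uIoc)
  · filter_upwards [hIoc] with ε hε
    filter_upwards [hae] with s ht hs
    rw [Set.uIoc_of_le hb] at hs
    have hc : Real.cos s ≠ 0 := fun h => ht (by rw [Real.tan_eq_sin_div_cos, h, div_zero])
    refine (abs_re_le_norm _).trans ?_
    rw [norm_mul, norm_I, one_mul, norm_contourIntegrand]
    refine (mul_le_of_le_one_right (norm_nonneg _) ?_).trans
      (norm_branch_le_of_re_le_one hε.1 hε.2.le hs.1.le hc)
    rw [Real.exp_le_one_iff]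
    nlinarith [hs.1]
  · filter_upwards [hae] with s ht hs
    rw [Set.uIoc_of_le hb] at hs
    have hlim : Tendsto (fun ε : ℝ => (ε : ℂ) + s * I) (𝓝[>] 0) (𝓝 (s * I)) := by
      have : Continuous fun ε : ℝ => (ε : ℂ) + s * I := by fun_prop
      simpa using this.tendsto 0 |>.mono_left nhdsWithin_le_nhds
    have hcb : ContinuousAt (fun z => (I * contourIntegrand x z).re) (s * I) :=
      continuous_re.continuousAt.comp (continuousAt_const.mul
        ((continuousAt_branch_mul_I hs.1 ht).mul (by fun_prop)))
    have hval : (I * contourIntegrand x (s * I)).re = density s * Real.exp (-x * s) := by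
      have h1 : exp (I * x * (s * I)) = (Real.exp (-x * s) : ℝ) := by
        rw [ofReal_exp]; congr 1; push_cast; linear_combination (x * s : ℂ) * I_mul_I
      rw [contourIntegrand, h1, ← mul_assoc, re_mul_ofReal, I_mul_branch_mul_I_re hs.1 ht, density]
    rw [← hval]
    exact hcb.tendsto.comp hlim

/-- The Laplace transform of the spectral density. -/
def laplace (x : ℝ) : ℝ := ∫ s in Set.Ioi 0, density s * Real.exp (-x * s)

/-- With `R` fixed, `ε → 0` and then `k → ∞`; the top-side error `R e^{-xkπ}` disappears, and the
right-side error alone remains. -/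
lemma abs_re_integral_sub_laplace_le {x R : ℝ} (hx : 0 < x) (hR : 1 ≤ R) :
    |(∫ ξ in (0 : ℝ)..R, (symbol ξ : ℂ) * exp (I * x * ξ)).re - laplace x| ≤ √(2 / R) / x := by
  have hb : ∀ k : ℕ, 1 ≤ k → |(∫ ξ in (0 : ℝ)..R, (symbol ξ : ℂ) * exp (I * x * ξ)).re -
      ∫ s in (0 : ℝ)..(k * Real.pi), density s * Real.exp (-x * s)| ≤
      √(2 / R) / x + R * Real.exp (-x * (k * Real.pi)) := by
    intro k hk
    have h1 : Tendsto (fun ε : ℝ => (∫ ξ in ε..R, (symbol ξ : ℂ) * exp (I * x * ξ)).re) (𝓝[>] 0)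
        (𝓝 (∫ ξ in (0 : ℝ)..R, (symbol ξ : ℂ) * exp (I * x * ξ)).re) := by
      have hc := intervalIntegral.continuous_primitive
        (fun a b => intervalIntegrable_symbol_mul_exp x a b) R
      have hc' : Continuous fun ε : ℝ =>
          (∫ ξ in ε..R, (symbol ξ : ℂ) * exp (I * x * ξ)).re := by
        refine continuous_re.comp ?_
        simp only [intervalIntegral.integral_symm R]
        exact hc.neg
      exact (hc'.tendsto 0).mono_left nhdsWithin_le_nhds
    have h2 := tendsto_re_integral_contour hx (b := k * Real.pi) (by positivity)
    refine le_of_tendsto (h1.sub h2).abs ?_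
    filter_upwards [Ioo_mem_nhdsGT zero_lt_one] with ε hε
    rw [← sub_re]
    exact (abs_re_le_norm _).trans (norm_contour_difference_le hx hR hk hε.1 hε.2.le)
  have hk : Tendsto (fun k : ℕ => (k : ℝ) * Real.pi) atTop atTop :=
    tendsto_natCast_atTop_atTop.atTop_mul_const Real.pi_pos
  have h3 := intervalIntegral_tendsto_integral_Ioi 0 (integrableOn_density_mul_exp hx) hk
  have h4 : Tendsto (fun k : ℕ => √(2 / R) / x + R * Real.exp (-x * (k * Real.pi))) atTop
      (𝓝 (√(2 / R) / x + R * 0)) := by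
    refine tendsto_const_nhds.add (tendsto_const_nhds.mul (Real.tendsto_exp_atBot.comp ?_))
    exact hk.const_mul_atTop_of_neg (neg_lt_zero.2 hx)
  rw [mul_zero, add_zero] at h4
  refine le_of_tendsto_of_tendsto (tendsto_const_nhds.sub h3).abs h4 ?_
  filter_upwards [eventually_ge_atTop 1] with k hk1 using hb k hk1

/-- Since `m` is even and real, the two half-line integrals are complex conjugates. Their sum is
twice a real part, which is even in `x`; hence `|x|`. -/
lemma truncatedKernel_eq (x R : ℝ) : truncatedKernel x R =
    ((1 / Real.pi * (∫ ξ in (0 : ℝ)..R, (symbol ξ : ℂ) * exp (I * (|x| : ℝ) * ξ)).re : ℝ) : ℂ) := by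
  have hconj : ∀ y : ℝ, (∫ ξ in (0 : ℝ)..R, (symbol ξ : ℂ) * exp (I * (-y : ℝ) * ξ)) =
      (starRingEnd ℂ) (∫ ξ in (0 : ℝ)..R, (symbol ξ : ℂ) * exp (I * y * ξ)) := by
    intro y
    rw [← intervalIntegral.intervalIntegral_conj]
    refine intervalIntegral.integral_congr fun ξ _ => ?_
    simp only [map_mul, conj_ofReal, ← exp_conj, conj_I]
    push_cast; ring_nf
  have hneg : ∀ y : ℝ, (∫ ξ in (-R)..0, (symbol ξ : ℂ) * exp (I * y * ξ)) =
      ∫ ξ in (0 : ℝ)..R, (symbol ξ : ℂ) * exp (I * (-y : ℝ) * ξ) := by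
    intro y
    have := intervalIntegral.integral_comp_neg (a := 0) (b := R)
      (fun ξ : ℝ => (symbol ξ : ℂ) * exp (I * y * ξ))
    rw [neg_zero] at this
    rw [← this]
    refine intervalIntegral.integral_congr fun ξ _ => ?_
    simp only [symbol_neg]
    push_cast; ring_nf
  have habs : (∫ ξ in (0 : ℝ)..R, (symbol ξ : ℂ) * exp (I * (|x| : ℝ) * ξ)).re =
      (∫ ξ in (0 : ℝ)..R, (symbol ξ : ℂ) * exp (I * x * ξ)).re := by
    rcases abs_choice x with h | h
    · rw [h]
    · rw [h, hconj, conj_re]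
  rw [truncatedKernel, ← intervalIntegral.integral_add_adjacent_intervals
    (intervalIntegrable_symbol_mul_exp x (-R) 0) (intervalIntegrable_symbol_mul_exp x 0 R),
    hneg, hconj, add_comm, add_conj, habs]
  push_cast
  have := Real.pi_ne_zero
  field_simp

lemma tendsto_truncatedKernel {x : ℝ} (hx : x ≠ 0) :
    Tendsto (truncatedKernel x) atTop (𝓝 ((1 / Real.pi * laplace |x| : ℝ) : ℂ)) := by
  have hx' := abs_pos.2 hx
  have h0 : Tendsto (fun R : ℝ => √(2 / R) / |x|) atTop (𝓝 0) := by
    have h1 : Tendsto (fun R : ℝ => 2 / R) atTop (𝓝 0) := tendsto_const_nhds.div_atTop tendsto_id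
    have h2 := (Real.continuous_sqrt.tendsto 0).comp h1
    rw [Real.sqrt_zero] at h2
    simpa using h2.div_const |x|
  have h1 : Tendsto (fun R : ℝ =>
      (∫ ξ in (0 : ℝ)..R, (symbol ξ : ℂ) * exp (I * (|x| : ℝ) * ξ)).re) atTop
      (𝓝 (laplace |x|)) := by
    rw [tendsto_iff_norm_sub_tendsto_zero]
    refine squeeze_zero' (Eventually.of_forall fun _ => norm_nonneg _) ?_ h0
    filter_upwards [eventually_ge_atTop 1] with R hR using
      abs_re_integral_sub_laplace_le hx' hR
  have h2 := (continuous_ofReal.tendsto _).comp (h1.const_mul (1 / Real.pi))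
  exact h2.congr fun R => (truncatedKernel_eq x R).symm

lemma kernel_eq_laplace {x : ℝ} (hx : x ≠ 0) : kernel x = 1 / Real.pi * laplace |x| := by
  rw [kernel, (tendsto_truncatedKernel hx).limUnder_eq, ofReal_re]

end Whitham
end

/-! ### Periodisation and the closed formula -/

noncomputable section

namespace Whitham

open MeasureTheory Filter Topology ProbabilityTheory

/-- This spectral gap neutralises the zero of `sinh(Ps/2)` at `s = 0` and gives the terms of the
periodisation geometric decay. -/
lemma density_eq_zero {s : ℝ} (h0 : 0 ≤ s) (h1 : s ≤ Real.pi / 2) : density s = 0 :=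
  if_neg (not_lt.2 (Real.tan_nonneg_of_nonneg_of_le_pi_div_two h0 h1))

/-- The measure on `(0, ∞)` whose two-sided Laplace transform is the periodised kernel. -/
def periodicMeasure (P : ℝ) : Measure ℝ :=
  (volume.restrict (Set.Ioi 0)).withDensity
    fun s => ENNReal.ofReal (density s / (2 * Real.sinh (P / 2 * s)))

lemma measurable_periodicDensity (P : ℝ) :
    Measurable fun s => density s / (2 * Real.sinh (P / 2 * s)) :=
  measurable_density.div ((Real.measurable_sinh.comp (measurable_const_mul _)).const_mul _)

variable {P : ℝ}

lemma periodicDensity_nonneg (hP : 0 < P) {s : ℝ} (hs : 0 < s) :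
    0 ≤ density s / (2 * Real.sinh (P / 2 * s)) :=
  div_nonneg (density_nonneg s) (by
    have := Real.sinh_pos_iff.2 (show 0 < P / 2 * s by positivity); positivity)

lemma ae_pos_periodicMeasure (P : ℝ) : ∀ᵐ s ∂periodicMeasure P, 0 < s :=
  (withDensity_absolutelyContinuous _ _).ae_le (ae_restrict_mem measurableSet_Ioi)

lemma integral_periodicMeasure (hP : 0 < P) (g : ℝ → ℝ) : ∫ s, g s ∂periodicMeasure P =
    ∫ s in Set.Ioi 0, density s / (2 * Real.sinh (P / 2 * s)) * g s := by
  rw [periodicMeasure, integral_withDensity_eq_integral_toReal_smul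
    (measurable_periodicDensity P).ennreal_ofReal (Eventually.of_forall fun _ =>
      ENNReal.ofReal_lt_top)]
  refine setIntegral_congr_fun measurableSet_Ioi fun s hs => ?_
  simp only [ENNReal.toReal_ofReal (periodicDensity_nonneg hP hs), smul_eq_mul]

lemma integrable_periodicMeasure_iff (hP : 0 < P) (g : ℝ → ℝ) :
    Integrable g (periodicMeasure P) ↔
    IntegrableOn (fun s => density s / (2 * Real.sinh (P / 2 * s)) * g s) (Set.Ioi 0) := by
  rw [periodicMeasure, integrable_withDensity_iff_integrable_smul'
    (measurable_periodicDensity P).ennreal_ofReal (Eventually.of_forall fun _ =>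
      ENNReal.ofReal_lt_top)]
  refine integrableOn_congr_fun (fun s hs => ?_) measurableSet_Ioi
  simp only [ENNReal.toReal_ofReal (periodicDensity_nonneg hP hs), smul_eq_mul]

/-- The right side is the summed geometric series of ratio `e^{-Ps}`; both the integrability and the
summation below pass through this form. -/
lemma periodicDensity_mul_exp (hP : 0 < P) {s : ℝ} (hs : 0 < s) (t : ℝ) :
    density s / (2 * Real.sinh (P / 2 * s)) * Real.exp (t * s) =
      density s * Real.exp (-(P / 2 - t) * s) * (1 - Real.exp (-P * s))⁻¹ := by
  have h1 : 0 < 2 * Real.sinh (P / 2 * s) := by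
    have := Real.sinh_pos_iff.2 (show 0 < P / 2 * s by positivity); positivity
  have h2 : 0 < 1 - Real.exp (-P * s) := by
    rw [sub_pos, Real.exp_lt_one_iff]; nlinarith
  have h3 : Real.exp (t * s) * (1 - Real.exp (-P * s)) =
      Real.exp (-(P / 2 - t) * s) * (2 * Real.sinh (P / 2 * s)) := by
    rw [Real.sinh_eq, mul_div_cancel₀ _ two_ne_zero, mul_sub, mul_sub, ← Real.exp_add,
      ← Real.exp_add, ← Real.exp_add, mul_one]
    ring_nf
  rw [div_mul_eq_mul_div, ← div_eq_mul_inv, div_eq_div_iff h1.ne' h2.ne']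
  linear_combination density s * h3

lemma integrable_exp_mul_periodicMeasure (hP : 0 < P) {t : ℝ} (ht : t < P / 2) :
    Integrable (fun s => Real.exp (t * s)) (periodicMeasure P) := by
  rw [integrable_periodicMeasure_iff hP]
  have hx : 0 < P / 2 - t := by linarith
  refine ((integrableOn_density_mul_exp hx).mul_const (1 - Real.exp (-P))⁻¹).mono'
    ((measurable_periodicDensity P).mul (by fun_prop)).aestronglyMeasurable ?_
  refine (ae_restrict_iff' measurableSet_Ioi).2 (Eventually.of_forall fun s hs => ?_)
  rw [Real.norm_of_nonneg (mul_nonneg (periodicDensity_nonneg hP hs) (Real.exp_pos _).le),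
    periodicDensity_mul_exp hP hs]
  rcases le_total s (Real.pi / 2) with h | h
  · rw [density_eq_zero (le_of_lt hs) h]; simp
  · have h1 : 1 ≤ s := by linarith [Real.pi_gt_three]
    have h2 : 0 < 1 - Real.exp (-P) := by
      rw [sub_pos, Real.exp_lt_one_iff]; linarith
    refine mul_le_mul_of_nonneg_left ?_ (mul_nonneg (density_nonneg s) (Real.exp_pos _).le)
    refine inv_anti₀ h2 (sub_le_sub_left (Real.exp_le_exp.2 ?_) _)
    nlinarith

lemma _root_.HasSum.congr_of_eq {ι : Type*} {f g : ι → ℝ} {a b : ℝ} (h : HasSum f a)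
    (hfg : ∀ i, g i = f i) (hab : b = a) : HasSum g b := by
  rwa [hab, funext hfg]

/-- Sum and integral are exchanged: as `s ≥ 1` on the support of the density, the `n`-th integral is
at most `e^{-nP}` times the `0`-th one. -/
lemma hasSum_laplace_add_nat_mul (hP : 0 < P) {y : ℝ} (hy : 0 < y) :
    HasSum (fun n : ℕ => laplace (y + n * P)) (mgf id (periodicMeasure P) (P / 2 - y)) := by
  have hpos : ∀ n : ℕ, 0 < y + n * P := fun n => by positivity
  have hnn : ∀ (z s : ℝ), 0 ≤ density s * Real.exp (-z * s) := fun z s =>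
    mul_nonneg (density_nonneg s) (Real.exp_pos _).le
  have hr0 := Real.exp_pos (-P)
  have hr : Real.exp (-P) < 1 := by rw [Real.exp_lt_one_iff]; linarith
  have hsum : Summable fun n : ℕ =>
      ∫ s in Set.Ioi 0, ‖density s * Real.exp (-(y + n * P) * s)‖ := by
    refine Summable.of_nonneg_of_le (fun n => integral_nonneg fun s => norm_nonneg _)
      (fun n => ?_) ((summable_geometric_of_lt_one hr0.le hr).mul_right (laplace y))
    simp only [Real.norm_of_nonneg (hnn _ _)]
    rw [laplace, ← integral_const_mul]
    refine setIntegral_mono_on (integrableOn_density_mul_exp (hpos n))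
      ((integrableOn_density_mul_exp hy).const_mul _) measurableSet_Ioi fun s hs => ?_
    rcases le_total s (Real.pi / 2) with h | h
    · rw [density_eq_zero (le_of_lt hs) h]; simp
    · have h1 : 1 ≤ s := by linarith [Real.pi_gt_three]
      rw [mul_left_comm, ← Real.exp_nat_mul, ← Real.exp_add]
      refine mul_le_mul_of_nonneg_left (Real.exp_le_exp.2 ?_) (density_nonneg s)
      have : 0 ≤ (n : ℝ) * P := by positivity
      nlinarith
  have h := hasSum_integral_of_summable_integral_norm
    (fun n => integrableOn_density_mul_exp (hpos n)) hsum
  refine h.congr_of_eq (fun _ => rfl) ?_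
  change ∫ s, Real.exp ((P / 2 - y) * s) ∂periodicMeasure P = _
  rw [integral_periodicMeasure hP]
  refine setIntegral_congr_fun measurableSet_Ioi fun s hs => ?_
  have hq : Real.exp (-P * s) < 1 := by
    rw [Real.exp_lt_one_iff]; nlinarith [show (0 : ℝ) < s from hs]
  have hterm : ∀ n : ℕ, density s * Real.exp (-(y + n * P) * s) =
      density s * Real.exp (-y * s) * Real.exp (-P * s) ^ n := fun n => by
    rw [← Real.exp_nat_mul, mul_assoc, ← Real.exp_add]; ring_nf
  simp only [hterm]
  rw [tsum_mul_left, tsum_geometric_of_lt_one (Real.exp_pos _).le hq,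
    periodicDensity_mul_exp hP hs]
  ring_nf

/-- The two-sided Laplace transform `t ↦ ∫ 2 cosh (s t) dν(s)` of the periodic measure `ν`. -/
def coshTransform (P t : ℝ) : ℝ :=
  mgf id (periodicMeasure P) t + mgf id (periodicMeasure P) (-t)

lemma mem_multiples_iff (hP : 0 < P) {x : ℝ} : x ∈ multiples P ↔ x - P * (⌊x / P⌋ : ℝ) = 0 := by
  constructor
  · rintro ⟨k, rfl⟩
    simp only [mul_div_cancel_right₀ _ hP.ne', Int.floor_intCast]; ring
  · intro h
    exact ⟨⌊x / P⌋, by simp only; linarith⟩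

lemma sub_floor_mem_Ioo (hP : 0 < P) {x : ℝ} (hx : x ∉ multiples P) :
    x - P * (⌊x / P⌋ : ℝ) ∈ Set.Ioo 0 P := by
  have h1 := Int.floor_le (x / P)
  have h2 := Int.lt_floor_add_one (x / P)
  rw [le_div_iff₀ hP] at h1
  rw [div_lt_iff₀ hP] at h2
  refine ⟨lt_of_le_of_ne (by linarith) fun h => hx ((mem_multiples_iff hP).2 h.symm), by linarith⟩

lemma hasSum_kernel_of_mem_Ioo (hP : 0 < P) {y : ℝ} (hy : y ∈ Set.Ioo 0 P) :
    HasSum (fun n : ℤ => kernel (y + n * P)) (1 / Real.pi * coshTransform P (y - P / 2)) := by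
  have h1 := hasSum_laplace_add_nat_mul hP hy.1
  have h2 := hasSum_laplace_add_nat_mul hP (sub_pos.2 hy.2)
  rw [coshTransform, mul_add, add_comm, neg_sub]
  rw [show P / 2 - (P - y) = y - P / 2 by ring] at h2
  -- The index `-(n+1)` gives `y - (n+1)P = -((P - y) + nP)`, so by evenness the negative half is
  -- the nonnegative half at `P - y`.
  refine HasSum.of_nat_of_neg_add_one
    ((h1.mul_left (1 / Real.pi)).congr_of_eq (fun n => ?_) rfl)
    ((h2.mul_left (1 / Real.pi)).congr_of_eq (fun n => ?_) rfl)
  · have : 0 < y + n * P := by have := hy.1; positivity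
    rw [Int.cast_natCast, kernel_eq_laplace this.ne', abs_of_pos this]
  · have h0 : 0 ≤ (n : ℝ) * P := by positivity
    have : y + ((-((n : ℤ) + 1) : ℤ) : ℝ) * P = -(P - y + n * P) := by push_cast; ring
    have h3 : 0 < P - y + n * P := by have := hy.2; linarith
    rw [this, kernel_eq_laplace (neg_ne_zero.2 h3.ne'), abs_neg, abs_of_pos h3]

lemma hasSum_kernel (hP : 0 < P) {x : ℝ} (hx : x ∉ multiples P) :
    HasSum (fun n : ℤ => kernel (x + n * P))
      (1 / Real.pi * coshTransform P (x - P / 2 - P * (⌊x / P⌋ : ℝ))) := by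
  have h := hasSum_kernel_of_mem_Ioo hP (sub_floor_mem_Ioo hP hx)
  -- The sum over `ℤ` is invariant under shifting the index, which reduces `x` to its representative
  -- in `(0, P)`.
  rw [← (Equiv.addRight ⌊x / P⌋).hasSum_iff] at h
  refine h.congr_of_eq (fun n => ?_) ?_
  · simp only [Function.comp_apply, Equiv.coe_addRight, Int.cast_add]; ring_nf
  · ring_nf

lemma periodicKernel_eq (hP : 0 < P) {x : ℝ} (hx : x ∉ multiples P) :
    periodicKernel P x =
      1 / Real.pi * coshTransform P (x - P / 2 - P * (⌊x / P⌋ : ℝ)) :=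
  (hasSum_kernel hP hx).tsum_eq

/-! ### The series of integrals -/

/-- The `n`-th interval on which `tan` is negative. -/
def negInterval (n : ℕ+) : Set ℝ := Set.Ioo ((2 * (n : ℝ) - 1) * Real.pi / 2) ((n : ℝ) * Real.pi)

lemma one_le_pnat_cast (n : ℕ+) : (1 : ℝ) ≤ n := by exact_mod_cast n.pos

lemma negInterval_subset (n : ℕ+) : negInterval n ⊆ Set.Ioi 0 := fun s hs => by
  have := one_le_pnat_cast n
  have h := hs.1
  have : 0 < (2 * (n : ℝ) - 1) * Real.pi / 2 := by
    have : 0 < 2 * (n : ℝ) - 1 := by linarith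
    positivity
  exact this.trans h

lemma tan_neg_of_mem_negInterval {n : ℕ+} {s : ℝ} (hs : s ∈ negInterval n) : Real.tan s < 0 := by
  rw [← Real.tan_sub_nat_mul_pi s n]
  exact Real.tan_neg_of_neg_of_pi_div_two_lt (by linarith [hs.2]) (by linarith [hs.1])

lemma iUnion_negInterval : ⋃ n, negInterval n = {s : ℝ | 0 < s ∧ Real.tan s < 0} := by
  ext s
  simp only [Set.mem_iUnion, Set.mem_ofPred_eq]
  constructor
  · rintro ⟨n, hn⟩
    exact ⟨negInterval_subset n hn, tan_neg_of_mem_negInterval hn⟩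
  · rintro ⟨h0, ht⟩
    set k := ⌊s / Real.pi⌋₊ with hk
    have h1 := Nat.floor_le (show 0 ≤ s / Real.pi by positivity)
    have h2 := Nat.lt_floor_add_one (s / Real.pi)
    rw [← hk, le_div_iff₀ Real.pi_pos] at h1
    rw [← hk, div_lt_iff₀ Real.pi_pos] at h2
    -- On `(kπ, (k+1)π)` the tangent is negative exactly in the second half, which is the interval
    -- of index `k + 1`.
    refine ⟨k.succPNat, ?_, ?_⟩
    · by_contra hcon
      rw [not_lt, Nat.succPNat_coe] at hcon
      push_cast at hcon
      have := Real.tan_nonneg_of_nonneg_of_le_pi_div_two (x := s - k * Real.pi) (by linarith)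
        (by linarith)
      rw [Real.tan_sub_nat_mul_pi] at this
      exact absurd ht (not_lt.2 this)
    · rw [Nat.succPNat_coe]; push_cast; exact h2

lemma pairwise_disjoint_negInterval : Pairwise (Function.onFun Disjoint negInterval) := by
  have key : ∀ m n : ℕ+, m < n → Disjoint (negInterval m) (negInterval n) := by
    intro m n h
    have h' : (m : ℝ) + 1 ≤ n := by exact_mod_cast (PNat.add_one_le_iff.2 h)
    refine Set.disjoint_left.2 fun s hm hn => ?_
    have h1 := hm.2
    have h2 := hn.1
    nlinarith [Real.pi_pos]
  intro m n h
  rcases lt_or_gt_of_ne h with h | h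
  exacts [key m n h, (key n m h).symm]

lemma coshTransform_integrand (hP : 0 < P) (x : ℝ) {s : ℝ} (hs : 0 < s)
    (ht : Real.tan s < 0) :
    density s / (2 * Real.sinh (P / 2 * s)) *
      (Real.exp ((x - P / 2 - P * (⌊x / P⌋ : ℝ)) * s) +
        Real.exp (-(x - P / 2 - P * (⌊x / P⌋ : ℝ)) * s)) = periodicIntegrand P x s := by
  have h1 : Real.sinh (P / 2 * s) ≠ 0 :=
    (Real.sinh_pos_iff.2 (show 0 < P / 2 * s by positivity)).ne'
  rw [periodicIntegrand, Real.cosh_eq, density, if_pos ht, weight, mul_comm s, neg_mul]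
  field_simp

lemma abs_offset_lt (hP : 0 < P) {x : ℝ} (hx : x ∉ multiples P) :
    |x - P / 2 - P * (⌊x / P⌋ : ℝ)| < P / 2 := by
  have h := sub_floor_mem_Ioo hP hx
  exact abs_lt.2 ⟨by linarith [h.1], by linarith [h.2]⟩

lemma integrable_exp_add_exp (hP : 0 < P) {t : ℝ} (ht : |t| < P / 2) :
    Integrable (fun s => Real.exp (t * s) + Real.exp (-t * s)) (periodicMeasure P) :=
  (integrable_exp_mul_periodicMeasure hP (abs_lt.1 ht).2).add
    (integrable_exp_mul_periodicMeasure hP (by linarith [(abs_lt.1 ht).1]))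

lemma coshTransform_eq_integral (hP : 0 < P) {t : ℝ} (ht : |t| < P / 2) :
    coshTransform P t = ∫ s, (Real.exp (t * s) + Real.exp (-t * s)) ∂periodicMeasure P := by
  rw [integral_add (integrable_exp_mul_periodicMeasure hP (abs_lt.1 ht).2)
    (integrable_exp_mul_periodicMeasure hP (by linarith [(abs_lt.1 ht).1]))]
  rfl

lemma measurableSet_iUnion_negInterval : MeasurableSet (⋃ n, negInterval n) :=
  MeasurableSet.iUnion fun _ => measurableSet_Ioo

lemma integrableOn_periodicIntegrand (hP : 0 < P) {x : ℝ} (hx : x ∉ multiples P) :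
    IntegrableOn (periodicIntegrand P x) (⋃ n, negInterval n) := by
  have h := (integrable_periodicMeasure_iff hP _).1
    (integrable_exp_add_exp hP (abs_offset_lt hP hx))
  refine (integrableOn_congr_fun (fun s hs => ?_) measurableSet_iUnion_negInterval).1
    (h.mono_set (Set.iUnion_subset negInterval_subset))
  rw [iUnion_negInterval] at hs
  exact coshTransform_integrand hP x hs.1 hs.2

lemma setIntegral_periodicIntegrand (hP : 0 < P) {x : ℝ} (hx : x ∉ multiples P) :
    ∫ s in ⋃ n, negInterval n, periodicIntegrand P x s =
      coshTransform P (x - P / 2 - P * (⌊x / P⌋ : ℝ)) := by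
  rw [coshTransform_eq_integral hP (abs_offset_lt hP hx), integral_periodicMeasure hP,
    setIntegral_eq_of_subset_of_forall_sdiff_eq_zero measurableSet_Ioi
    (Set.iUnion_subset negInterval_subset)]
  · refine setIntegral_congr_fun measurableSet_iUnion_negInterval fun s hs => ?_
    rw [iUnion_negInterval] at hs
    exact (coshTransform_integrand hP x hs.1 hs.2).symm
  · rintro s ⟨hs, hs'⟩
    rw [iUnion_negInterval] at hs'
    have : density s = 0 := if_neg fun h => hs' ⟨hs, h⟩
    simp [this]

lemma pnat_endpoints_le (n : ℕ+) : (2 * (n : ℝ) - 1) * Real.pi / 2 ≤ (n : ℝ) * Real.pi := by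
  linarith [Real.pi_pos]

lemma intervalIntegrable_periodicIntegrand (hP : 0 < P) {x : ℝ} (hx : x ∉ multiples P) (n : ℕ+) :
    IntervalIntegrable (periodicIntegrand P x) volume ((2 * (n : ℝ) - 1) * Real.pi / 2)
      ((n : ℝ) * Real.pi) := by
  rw [intervalIntegrable_iff_integrableOn_Ioo_of_le (pnat_endpoints_le n)]
  exact (integrableOn_periodicIntegrand hP hx).mono_set (Set.subset_iUnion negInterval n)

/-- Countable additivity over the disjoint intervals where `tan < 0`, from integrability over their
union. -/
lemma hasSum_integral_periodicIntegrand (hP : 0 < P) {x : ℝ} (hx : x ∉ multiples P) :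
    HasSum (fun n : ℕ+ => ∫ s in ((2 * (n : ℝ) - 1) * Real.pi / 2)..((n : ℝ) * Real.pi),
      periodicIntegrand P x s) (Real.pi * periodicKernel P x) := by
  have h := hasSum_integral_iUnion (s := negInterval) (fun n => measurableSet_Ioo) pairwise_disjoint_negInterval
    (integrableOn_periodicIntegrand hP hx)
  rw [setIntegral_periodicIntegrand hP hx] at h
  rw [periodicKernel_eq hP hx, ← mul_assoc, mul_one_div_cancel Real.pi_ne_zero, one_mul]
  refine h.congr_of_eq (fun n => ?_) rfl
  rw [intervalIntegral.integral_of_le (pnat_endpoints_le n), integral_Ioc_eq_integral_Ioo,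
    negInterval]

end Whitham
end

/-! ### Smoothness, complete monotonicity, positivity, strict decrease, convexity -/

noncomputable section

namespace Whitham

open MeasureTheory Filter Topology ProbabilityTheory
open scoped ContDiff

variable {P : ℝ}

lemma mem_interior_integrableExpSet (hP : 0 < P) {t : ℝ} (ht : t < P / 2) :
    t ∈ interior (integrableExpSet id (periodicMeasure P)) :=
  interior_maximal (s := integrableExpSet id (periodicMeasure P)) (t := Set.Iio (P / 2))
    (fun _ hu => integrable_exp_mul_periodicMeasure hP hu) isOpen_Iio ht

lemma contDiffAt_mgf (hP : 0 < P) {t : ℝ} (ht : t < P / 2) {n : WithTop ℕ∞} :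
    ContDiffAt ℝ n (mgf id (periodicMeasure P)) t :=
  (analyticOnNhd_mgf t (mem_interior_integrableExpSet hP ht)).contDiffAt

lemma contDiffAt_mgf_neg (hP : 0 < P) {t : ℝ} (ht : -(P / 2) < t) {n : WithTop ℕ∞} :
    ContDiffAt ℝ n (fun t => mgf id (periodicMeasure P) (-t)) t :=
  (contDiffAt_mgf hP (by linarith : -t < P / 2)).comp t contDiff_neg.contDiffAt

lemma contDiffAt_coshTransform (hP : 0 < P) {t : ℝ} (ht : |t| < P / 2) {n : WithTop ℕ∞} :
    ContDiffAt ℝ n (coshTransform P) t :=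
  (contDiffAt_mgf hP (abs_lt.1 ht).2).add (contDiffAt_mgf_neg hP (abs_lt.1 ht).1)

lemma integrable_pow_mul_exp (hP : 0 < P) {t : ℝ} (ht : t < P / 2) (n : ℕ) :
    Integrable (fun s : ℝ => s ^ n * Real.exp (t * s)) (periodicMeasure P) :=
  integrable_pow_mul_exp_of_mem_interior_integrableExpSet (mem_interior_integrableExpSet hP ht) n

/-- Each derivative of the moment generating function brings down a factor `s`; the reflected copy
also brings a sign, which the factor `(-1)^n` moves to the other exponential. -/
lemma iteratedDeriv_coshTransform (hP : 0 < P) {t : ℝ} (ht : |t| < P / 2) (n : ℕ) :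
    (-1) ^ n * iteratedDeriv n (coshTransform P) t =
      ∫ s, s ^ n * (Real.exp (-t * s) + (-1) ^ n * Real.exp (t * s)) ∂periodicMeasure P := by
  have h1 := (abs_lt.1 ht).1
  have h2 := (abs_lt.1 ht).2
  have h3 : -t < P / 2 := by linarith
  have e : coshTransform P =
      fun t => mgf id (periodicMeasure P) t + mgf id (periodicMeasure P) (-t) := rfl
  rw [e, iteratedDeriv_fun_add (contDiffAt_mgf hP h2) (contDiffAt_mgf_neg hP h1),
    iteratedDeriv_comp_neg, iteratedDeriv_mgf (mem_interior_integrableExpSet hP h2),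
    iteratedDeriv_mgf (mem_interior_integrableExpSet hP h3), smul_eq_mul, mul_add, ← mul_assoc,
    ← pow_add, Even.neg_one_pow ⟨n, rfl⟩, one_mul, ← integral_const_mul]
  simp only [id]
  rw [← integral_add ((integrable_pow_mul_exp hP h2 n).const_mul _) (integrable_pow_mul_exp hP h3 n)]
  refine integral_congr_ae (Eventually.of_forall fun s => ?_)
  ring

lemma zero_le_neg_one_pow_mul_iteratedDeriv_coshTransform (hP : 0 < P) {t : ℝ}
    (ht : -(P / 2) < t) (ht0 : t ≤ 0) (n : ℕ) :
    0 ≤ (-1) ^ n * iteratedDeriv n (coshTransform P) t := by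
  rw [iteratedDeriv_coshTransform hP (abs_lt.2 ⟨ht, by linarith⟩)]
  refine integral_nonneg_of_ae ?_
  filter_upwards [ae_pos_periodicMeasure P] with s hs
  refine mul_nonneg (pow_nonneg hs.le n) ?_
  have h : Real.exp (t * s) ≤ Real.exp (-t * s) := Real.exp_le_exp.2 (by nlinarith)
  -- The bracket is `2 cosh(ts)` for even `n` and `2 sinh(-ts)` for odd `n`, the latter nonnegative
  -- because `t ≤ 0 < s`.
  rcases neg_one_pow_eq_or ℝ n with hn | hn <;> rw [hn]
  · positivity
  · linarith

/-- The density is strictly positive on `(π/2, π)`. Strict positivity and strict monotonicity of the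
transform both rest on this. -/
lemma periodicMeasure_ne_zero (hP : 0 < P) : periodicMeasure P ≠ 0 := by
  intro h
  rw [periodicMeasure, withDensity_eq_zero_iff
    (measurable_periodicDensity P).ennreal_ofReal.aemeasurable] at h
  have hmono := ae_mono (Measure.restrict_mono (negInterval_subset 1) le_rfl) h
  have hfalse : ∀ᵐ s ∂(volume.restrict (negInterval 1)), False := by
    filter_upwards [hmono, ae_restrict_mem measurableSet_Ioo] with s hs hmem
    have hs0 : 0 < s := negInterval_subset 1 hmem
    have ht := tan_neg_of_mem_negInterval hmem
    have h1 := Real.sinh_pos_iff.2 (show 0 < P / 2 * s by positivity)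
    have h2 : 0 < density s := by
      rw [density, if_pos ht, weight]
      exact Real.sqrt_pos.2 (div_pos (abs_pos.2 ht.ne) hs0)
    have h3 : 0 < density s / (2 * Real.sinh (P / 2 * s)) := by positivity
    exact (ENNReal.ofReal_pos.2 h3).ne' hs
  rw [eventually_false_iff_eq_bot, ae_eq_bot, Measure.restrict_eq_zero, negInterval,
    Real.volume_Ioo, ENNReal.ofReal_eq_zero] at hfalse
  have := Real.pi_pos
  norm_num at hfalse
  linarith

lemma coshTransform_pos (hP : 0 < P) {t : ℝ} (ht : |t| < P / 2) : 0 < coshTransform P t :=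
  add_pos_of_pos_of_nonneg (mgf_pos' (periodicMeasure_ne_zero hP)
    (integrable_exp_mul_periodicMeasure hP (abs_lt.1 ht).2)) mgf_nonneg

lemma convexOn_mgf (hP : 0 < P) :
    ConvexOn ℝ (Set.Iio (P / 2)) (mgf id (periodicMeasure P)) := by
  refine ⟨convex_Iio _, fun u hu v hv a b ha hb hab => ?_⟩
  have hu' := integrable_exp_mul_periodicMeasure hP hu
  have hv' := integrable_exp_mul_periodicMeasure hP hv
  have huv := integrable_exp_mul_periodicMeasure hP (convex_Iio (P / 2) hu hv ha hb hab)
  simp only [mgf, id, smul_eq_mul] at huv ⊢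
  rw [← integral_const_mul, ← integral_const_mul, ← integral_add (hu'.const_mul a)
    (hv'.const_mul b)]
  refine integral_mono huv ((hu'.const_mul a).add (hv'.const_mul b)) fun s => ?_
  have := convexOn_exp.2 (Set.mem_univ (u * s)) (Set.mem_univ (v * s)) ha hb hab
  simp only [smul_eq_mul] at this
  convert this using 2
  ring

lemma convexOn_coshTransform (hP : 0 < P) :
    ConvexOn ℝ (Set.Ioo (-(P / 2)) (P / 2)) (coshTransform P) := by
  have h1 := (convexOn_mgf hP).subset Set.Ioo_subset_Iio_self (convex_Ioo (-(P / 2)) (P / 2))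
  refine h1.add ⟨convex_Ioo _ _, fun u hu v hv a b ha hb hab => ?_⟩
  have := (convexOn_mgf hP).2 (x := -u) (show -u < P / 2 by linarith [hu.1])
    (y := -v) (show -v < P / 2 by linarith [hv.1]) ha hb hab
  convert this using 2
  simp only [smul_eq_mul]; ring

/-- For `u < v < 0 < s` one has `cosh(vs) < cosh(us)`; the integral of this positive difference
could vanish only for the zero measure. -/
lemma coshTransform_strictAntiOn (hP : 0 < P) :
    StrictAntiOn (coshTransform P) (Set.Ioo (-(P / 2)) 0) := by
  intro u hu v hv huv
  have hu' : |u| < P / 2 := abs_lt.2 ⟨hu.1, by linarith [hu.2]⟩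
  have hv' : |v| < P / 2 := abs_lt.2 ⟨hv.1, by linarith [hv.2]⟩
  rw [coshTransform_eq_integral hP hu', coshTransform_eq_integral hP hv', ← sub_pos,
    ← integral_sub (integrable_exp_add_exp hP hu') (integrable_exp_add_exp hP hv')]
  set g : ℝ → ℝ := fun s => Real.exp (u * s) + Real.exp (-u * s) -
    (Real.exp (v * s) + Real.exp (-v * s)) with hg
  have hpos : ∀ᵐ s ∂periodicMeasure P, 0 < g s := by
    filter_upwards [ae_pos_periodicMeasure P] with s hs
    have h1 : Real.cosh (v * s) < Real.cosh (u * s) := by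
      rw [Real.cosh_lt_cosh, abs_of_neg (mul_neg_of_neg_of_pos hv.2 hs),
        abs_of_neg (mul_neg_of_neg_of_pos hu.2 hs)]
      nlinarith
    rw [Real.cosh_eq, Real.cosh_eq] at h1
    simp only [hg, neg_mul]
    linarith
  refine lt_of_le_of_ne (integral_nonneg_of_ae (hpos.mono fun _ h => h.le)) fun h => ?_
  have h0 := (integral_eq_zero_iff_of_nonneg_ae (hpos.mono fun _ h => h.le)
    ((integrable_exp_add_exp hP hu').sub (integrable_exp_add_exp hP hv'))).1 h.symm
  have hfalse : ∀ᵐ s ∂periodicMeasure P, False := by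
    filter_upwards [hpos, h0] with s h1 h2 using h1.ne' h2
  rw [eventually_false_iff_eq_bot, ae_eq_bot] at hfalse
  exact periodicMeasure_ne_zero hP hfalse

lemma floor_div_eq (hP : 0 < P) {z : ℝ} {k : ℤ} (hz : z - P * k ∈ Set.Ioo 0 P) :
    ⌊z / P⌋ = k := by
  rw [Int.floor_eq_iff, le_div_iff₀ hP, div_lt_iff₀ hP]
  exact ⟨by linarith [hz.1], by linarith [hz.2]⟩

lemma notMem_multiples (hP : 0 < P) {z : ℝ} {k : ℤ} (hz : z - P * k ∈ Set.Ioo 0 P) :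
    z ∉ multiples P := by
  rw [mem_multiples_iff hP, floor_div_eq hP hz]
  exact hz.1.ne'

lemma periodicKernel_eq_of_sub_mem_Ioo (hP : 0 < P) {z : ℝ} {k : ℤ}
    (hz : z - P * k ∈ Set.Ioo 0 P) :
    periodicKernel P z = 1 / Real.pi * coshTransform P (z - (P / 2 + P * k)) := by
  rw [periodicKernel_eq hP (notMem_multiples hP hz), floor_div_eq hP hz]
  ring_nf

/-- The floor is locally constant off `P ℤ`, so near `x` the kernel is a translate of one smooth
function and its derivatives can be computed there. -/
lemma periodicKernel_eventuallyEq (hP : 0 < P) {x : ℝ} {k : ℤ} (hx : x - P * k ∈ Set.Ioo 0 P) :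
    periodicKernel P =ᶠ[𝓝 x]
      fun z => 1 / Real.pi * coshTransform P (z - (P / 2 + P * k)) := by
  have : ∀ᶠ z in 𝓝 x, z - P * k ∈ Set.Ioo 0 P :=
    (continuous_id.sub continuous_const).continuousAt.eventually (isOpen_Ioo.mem_nhds hx)
  exact this.mono fun z hz => periodicKernel_eq_of_sub_mem_Ioo hP hz

lemma contDiffAt_periodicKernel (hP : 0 < P) {x : ℝ} (hx : x ∉ multiples P) {n : WithTop ℕ∞} :
    ContDiffAt ℝ n (periodicKernel P) x := by
  refine ContDiffAt.congr_of_eventuallyEq ?_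
    (periodicKernel_eventuallyEq hP (sub_floor_mem_Ioo hP hx))
  have h := abs_offset_lt hP hx
  rw [sub_sub] at h
  exact contDiffAt_const.mul ((contDiffAt_coshTransform hP h).comp x
    (contDiffAt_id.sub contDiffAt_const))

lemma periodicKernel_eq_of_mem_Ioo (hP : 0 < P) {z : ℝ} (hz : z ∈ Set.Ioo 0 P) :
    periodicKernel P z = 1 / Real.pi * coshTransform P (z - P / 2) := by
  simpa using periodicKernel_eq_of_sub_mem_Ioo hP (k := 0) (by simpa using hz)

lemma notMem_multiples_of_mem_Ioo (hP : 0 < P) {z : ℝ} (hz : z ∈ Set.Ioo 0 P) :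
    z ∉ multiples P :=
  notMem_multiples hP (k := 0) (by simpa using hz)

lemma completelyMonotoneOnIoo_periodicKernel (hP : 0 < P) :
    CompletelyMonotoneOnIoo (periodicKernel P) 0 (P / 2) := by
  refine ⟨fun x hx => ?_, fun n x hx => ?_⟩
  · exact (contDiffAt_periodicKernel hP (notMem_multiples_of_mem_Ioo hP
      ⟨hx.1, by linarith [hx.2]⟩)).contDiffWithinAt
  · have h := periodicKernel_eventuallyEq hP (x := x) (k := 0) (by
      simpa using ⟨hx.1, by linarith [hx.2]⟩)
    rw [h.iteratedDeriv_eq, iteratedDeriv_const_mul_field,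
      iteratedDeriv_comp_sub_const, mul_left_comm]
    refine mul_nonneg (by positivity)
      (zero_le_neg_one_pow_mul_iteratedDeriv_coshTransform hP ?_ ?_ n)
    · simpa using hx.1
    · simpa using hx.2.le

lemma periodicKernel_pos (hP : 0 < P) {x : ℝ} (hx : x ∉ multiples P) :
    0 < periodicKernel P x := by
  rw [periodicKernel_eq hP hx]
  exact mul_pos (by positivity) (coshTransform_pos hP (abs_offset_lt hP hx))

lemma strictAntiOn_periodicKernel (hP : 0 < P) :
    StrictAntiOn (periodicKernel P) (Set.Ioo 0 (P / 2)) := by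
  intro x hx y hy hxy
  rw [periodicKernel_eq_of_mem_Ioo hP ⟨hx.1, by linarith [hx.2]⟩,
    periodicKernel_eq_of_mem_Ioo hP ⟨hy.1, by linarith [hy.2]⟩]
  refine mul_lt_mul_of_pos_left (coshTransform_strictAntiOn hP ?_ ?_ ?_) (by positivity)
  · exact ⟨by linarith [hx.1], by linarith [hx.2]⟩
  · exact ⟨by linarith [hy.1], by linarith [hy.2]⟩
  · linarith

lemma convexOn_periodicKernel (hP : 0 < P) : ConvexOn ℝ (Set.Ioo 0 P) (periodicKernel P) := by
  refine ⟨convex_Ioo _ _, fun x hx y hy a b ha hb hab => ?_⟩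
  have hmem : ∀ z ∈ Set.Ioo 0 P, z - P / 2 ∈ Set.Ioo (-(P / 2)) (P / 2) := fun z hz =>
    ⟨by linarith [hz.1], by linarith [hz.2]⟩
  have h := (convexOn_coshTransform hP).2 (hmem x hx) (hmem y hy) ha hb hab
  rw [periodicKernel_eq_of_mem_Ioo hP (convex_Ioo 0 P hx hy ha hb hab),
    periodicKernel_eq_of_mem_Ioo hP hx, periodicKernel_eq_of_mem_Ioo hP hy]
  have e : a • (x - P / 2) + b • (y - P / 2) = a • x + b • y - P / 2 := by
    simp only [smul_eq_mul]; linear_combination (-(P / 2)) * hab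
  rw [e] at h
  have h' := mul_le_mul_of_nonneg_left h (show 0 ≤ 1 / Real.pi by positivity)
  refine h'.trans_eq ?_
  simp only [smul_eq_mul]; ring

end Whitham
end


theorem corollary3p3 (P : ℝ) (hP : 0 < P) :
    -- the integral defining the kernel converges, with a real value, away from the origin
    (∀ x : ℝ, x ≠ 0 →
      Filter.Tendsto (Whitham.truncatedKernel x) Filter.atTop
        (nhds (Whitham.kernel x : ℂ))) ∧
    -- the periodisation converges absolutely off `P ℤ` and has the closed form
    (∀ x : ℝ, x ∉ Whitham.multiples P →
      Summable (fun n : ℤ => Whitham.kernel (x + n * P)) ∧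
      (∀ n : ℕ, 1 ≤ n →
        IntervalIntegrable (Whitham.periodicIntegrand P x) MeasureTheory.volume
          ((2 * (n : ℝ) - 1) * Real.pi / 2) ((n : ℝ) * Real.pi)) ∧
      HasSum
        (fun n : ℕ+ => ∫ s in ((2 * (n : ℝ) - 1) * Real.pi / 2)..((n : ℝ) * Real.pi),
          Whitham.periodicIntegrand P x s)
        (Real.pi * Whitham.periodicKernel P x) ∧
      Whitham.periodicKernel P x =
        1 / Real.pi * ∑' n : ℕ+,
          ∫ s in ((2 * (n : ℝ) - 1) * Real.pi / 2)..((n : ℝ) * Real.pi),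
            Whitham.periodicIntegrand P x s) ∧
    -- smoothness, complete monotonicity, and their consequences
    ContDiffOn ℝ ∞ (Whitham.periodicKernel P) (Whitham.multiples P)ᶜ ∧
    Whitham.CompletelyMonotoneOnIoo (Whitham.periodicKernel P) 0 (P / 2) ∧
    (∀ x : ℝ, x ∉ Whitham.multiples P → 0 < Whitham.periodicKernel P x) ∧
    StrictAntiOn (Whitham.periodicKernel P) (Set.Ioo 0 (P / 2)) ∧
    ConvexOn ℝ (Set.Ioo 0 P) (Whitham.periodicKernel P) := by
  refine ⟨fun x hx => ?_, fun x hx => ⟨(Whitham.hasSum_kernel hP hx).summable, fun n hn => ?_,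
    Whitham.hasSum_integral_periodicIntegrand hP hx, ?_⟩,
    fun x hx => (Whitham.contDiffAt_periodicKernel hP hx).contDiffWithinAt,
    Whitham.completelyMonotoneOnIoo_periodicKernel hP, fun x hx => Whitham.periodicKernel_pos hP hx,
    Whitham.strictAntiOn_periodicKernel hP, Whitham.convexOn_periodicKernel hP⟩
  · rw [Whitham.kernel_eq_laplace hx]
    exact Whitham.tendsto_truncatedKernel hx
  · exact Whitham.intervalIntegrable_periodicIntegrand hP hx ⟨n, hn⟩
  · rw [(Whitham.hasSum_integral_periodicIntegrand hP hx).tsum_eq, ← mul_assoc,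
      one_div_mul_cancel Real.pi_ne_zero, one_mul]
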